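/- Let $\mathbb{F}_q$ be a finite field, let $n\le m$, and let $\mathcal{C}$ be an $\mathbb{F}_q$-linear subspace of the space $\mathbb{F}_q^{n\times m}$ of $n\times m$ matrices, with $\{0\}\ne\mathcal{C}\ne\mathbb{F}_q^{n\times m}$ and $t=\dim\mathcal{C}$. Notation, for $\mathbb{F}_q$-subspaces $\mathcal{D}$ and $\mathcal{A}$ of $\mathbb{F}_q^{n\times m}$. The dual is $\mathcal{D}^\perp=\{B\in\mathbb{F}_q^{n\times m}:\mathrm{Tr}(BA^{T})=0\text{ for all }A\in\mathcal{D}\}$. For $\mathcal{D}\neq\{0\}$, the minimum distance is $d(\mathcal{D})=\min\{\mathrm{rk}(A):0\ne A\in\mathcal{D}\}$ and the rank defect is $\mathrm{rdef}(\mathcal{D})=n-\lceil \dim(\mathcal{D})/m\rceil+1-d(\mathcal{D})$. Put $\mathrm{maxrk}(\mathcal{A})=\max\{\mathrm{rk}(M):M\in\mathcal{A}\}$, and call $\mathcal{A}$ an optimal anticode if $\dim\mathcal{A}=m\cdot\mathrm{maxrk}(\mathcal{A})$. For $1\le r\le t$, the $r$-th generalized weight of $\mathcal{C}$ is $$a_r(\mathcal{C})=\min\{\mathrm{maxrk}(\mathcal{A}):\mathcal{A}\text{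 is an optimal anticode with }\dim(\mathcal{C}\cap\mathcal{A})\ge r\}.$$ For an integer $i$ with $1\le i\le\lceil t/m\rceil$ and $r=1+(i-1)m$, the code $\mathcal{C}$ is called $i$-MRD if $a_r(\mathcal{C})=n-\lfloor (t-r)/m\rfloor$ (it is not $i$-MRD for any other $i$). It is called $i$-MRD of degree $i-1$ if $i$ is the minimum integer for which $\mathcal{C}$ is $i$-MRD. Assume that $m\mid t$. Then the following hold. 1. If $a_{1+(\lceil t/m\rceil-1)m}(\mathcal{C})=n$, then for every integer $i\ge 0$, $\mathcal{C}$ is $i$-MRD of degree $i-1$ if and only if $\mathrm{rdef}(\mathcal{C}^\perp)=i-1$. 2. $a_{1+(\lceil t/m\rceil-1)m}(\mathcal{C})<n$ if and only if $\mathrm{rdef}(\mathcal{C}^\perp)=t/m$. -/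

import Mathlib

namespace RankMetric

/-- A linear rank-metric code over `F`: a subspace of the space of `n × m` matrices. -/
abbrev Code (F : Type*) [Field F] (n m : ℕ) : Type _ :=
  Submodule F (Matrix (Fin n) (Fin m) F)

variable {F : Type*} [Field F] {n m : ℕ}

/-- The dual code `{B | Tr(B Aᵀ) = 0 for all A ∈ C}`. -/
def dual (C : Code F n m) : Code F n m where
  carrier := {B | ∀ A ∈ C, (B * A.transpose).trace = 0}
  add_mem' := by
    intro B B' hB hB' A hA
    rw [Matrix.add_mul, Matrix.trace_add, hB A hA, hB' A hA, add_zero]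
  zero_mem' := by
    intro A _
    rw [Matrix.zero_mul, Matrix.trace_zero]
  smul_mem' := by
    intro c B hB A hA
    rw [Matrix.smul_mul, Matrix.trace_smul, hB A hA, smul_zero]

/-- The minimum distance: the least rank of a nonzero codeword
(for the zero code it is undefined, and here `0`). -/
noncomputable def minDist (C : Code F n m) : ℕ :=
  sInf {d | ∃ A ∈ C, A ≠ 0 ∧ A.rank = d}

/-- The rank defect `n - ⌈t / m⌉ + 1 - d` of a code of dimension `t` and minimum distance `d`. -/
noncomputable def rdef (C : Code F n m) : ℤ :=
  (n : ℤ) - ⌈(Module.finrank F C : ℚ) / (m : ℚ)⌉ + 1 - (minDist C : ℤ)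

/-- The maximum rank of a matrix in the code (a nonempty set of ranks, bounded by `n`). -/
noncomputable def maxrk (A : Code F n m) : ℕ :=
  sSup {k | ∃ M ∈ A, M.rank = k}

/-- An optimal anticode: a linear code with `dim A = m * maxrk A`. -/
def IsOptimalAnticode (A : Code F n m) : Prop :=
  Module.finrank F A = m * maxrk A

/-- The `r`-th generalized weight `a_r(C)`, meaningful for `1 ≤ r ≤ dim C`. -/
noncomputable def genWeight (C : Code F n m) (r : ℕ) : ℕ :=
  sInf {k | ∃ A : Code F n m,
    IsOptimalAnticode A ∧ r ≤ Module.finrank F (C ⊓ A : Code F n m) ∧ maxrk A = k}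

/-- `C` is `i`-MRD: `1 ≤ i ≤ ⌈t / m⌉` and, with `r = 1 + (i - 1) m`,
`a_r(C) = n - ⌊(t - r) / m⌋`, where `t = dim C`. -/
def IsIMRD (C : Code F n m) (i : ℕ) : Prop :=
  1 ≤ i ∧ i ≤ ⌈(Module.finrank F C : ℚ) / (m : ℚ)⌉₊ ∧
    (genWeight C (1 + (i - 1) * m) : ℤ) =
      (n : ℤ) - ⌊((Module.finrank F C : ℚ) - ((1 + (i - 1) * m : ℕ) : ℚ)) / (m : ℚ)⌋

/-- `C` is `i`-MRD of degree `i - 1`: `i` is the minimum index for which `C` is `i`-MRD. -/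
def IsIMRDOfDegreePred (C : Code F n m) (i : ℕ) : Prop :=
  IsLeast {j : ℕ | IsIMRD C j} i

end RankMetric

/-! Write `t = m * k` and let `d` be the minimum distance of the dual code, so that the rank defect
of the dual is `k + 1 - d`. Everything rests on `genWeight_lt_iff`: for `1 ≤ i ≤ k`, the weight at
index `1 + (i - 1) * m` drops below its Singleton-type bound `n - k + i` exactly when `d ≤ k - i +
1`. Hence `C` is `i`-MRD exactly for `k + 2 - d ≤ i ≤ k`. This range is nonempty iff `d > 1`, and
its least element gives part 1; the case `i = k` says that the last weight is below `n` iff `d = 1`,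
which is part 2.

For an anticode `A` of dimension `m * (n - k + i - 1)`, `finrank_inf_add` gives `dim (C ⊓ A) = (i -
1) * m + dim (dual C ⊓ dual A)`, so the weight condition says that the two duals meet nontrivially.
A dual codeword of low rank lies in a space `colCode m U`, whose dual is an anticode of the same
kind. Conversely, an optimal anticode attaining the weight is enlarged to the required maximum rank
(`exists_anticode_extension`), and its dual is shown to have small ranks (`rank_le_of_mem_dual`).

These two facts avoid the classification of optimal anticodes. The second plays the anticode against
Gabidulin codes moved by rank isometries; the first applies Hall's theorem to leading positions to
find a row or column along which to extend. -/

namespace RankMetric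

open Module

variable {F : Type*} [Field F] {n m : ℕ}

/-! ### Duality for the trace form. -/

section Dual

/-- The trace form `Tr(A Bᵀ)` on `n × m` matrices. -/
noncomputable def traceForm (F : Type*) [Field F] (n m : ℕ) :
    LinearMap.BilinForm F (Matrix (Fin n) (Fin m) F) :=
  LinearMap.mk₂ F (fun A B => (A * B.transpose).trace)
    (fun A A' B => by rw [Matrix.add_mul, Matrix.trace_add])
    (fun c A B => by rw [Matrix.smul_mul, Matrix.trace_smul])
    (fun A B B' => by rw [Matrix.transpose_add, Matrix.mul_add, Matrix.trace_add])
    (fun c A B => by rw [Matrix.transpose_smul, Matrix.mul_smul, Matrix.trace_smul])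

lemma trace_mul_transpose_comm (A B : Matrix (Fin n) (Fin m) F) :
    (A * B.transpose).trace = (B * A.transpose).trace := by
  rw [← Matrix.trace_transpose, Matrix.transpose_mul, Matrix.transpose_transpose]

lemma traceForm_isRefl : (traceForm F n m).IsRefl := fun A B h => by
  rw [traceForm, LinearMap.mk₂_apply] at h ⊢
  rw [trace_mul_transpose_comm, h]

lemma traceForm_nondegenerate : (traceForm F n m).Nondegenerate := by
  refine (LinearMap.IsRefl.nondegenerate_iff_separatingLeft (B := traceForm F n m)
    (fun A B h => traceForm_isRefl A B h)).2 fun A h => ?_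
  ext i j
  have := h (Matrix.single i j 1)
  rw [traceForm, LinearMap.mk₂_apply, Matrix.transpose_single, Matrix.trace_mul_single] at this
  simpa using this

lemma dual_eq_orthogonal (C : Code F n m) : dual C = (traceForm F n m).orthogonal C := by
  ext B
  simp only [LinearMap.BilinForm.mem_orthogonal_iff, traceForm,
    LinearMap.mk₂_apply]
  exact forall₂_congr fun A _ => by rw [trace_mul_transpose_comm]

lemma finrank_space : finrank F (Matrix (Fin n) (Fin m) F) = m * n := by
  rw [Module.finrank_matrix]; simp [mul_comm]

lemma finrank_add_finrank_dual (C : Code F n m) :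
    finrank F C + finrank F (dual C) = m * n := by
  have h := LinearMap.BilinForm.finrank_orthogonal traceForm_nondegenerate C
  have h' := Submodule.finrank_le C
  rw [dual_eq_orthogonal, h]
  rw [finrank_space] at h' ⊢
  omega

lemma dual_dual (C : Code F n m) : dual (dual C) = C := by
  rw [dual_eq_orthogonal, dual_eq_orthogonal,
    LinearMap.BilinForm.orthogonal_orthogonal traceForm_nondegenerate traceForm_isRefl]

lemma dual_anti {C D : Code F n m} (h : C ≤ D) : dual D ≤ dual C :=
  fun _ hB A hA => hB A (h hA)

lemma dual_sup (C D : Code F n m) : dual (C ⊔ D) = dual C ⊓ dual D := by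
  refine le_antisymm (le_inf (dual_anti le_sup_left) (dual_anti le_sup_right)) ?_
  rintro B ⟨hC, hD⟩ A hA
  obtain ⟨X, hX, Y, hY, rfl⟩ := Submodule.mem_sup.1 hA
  rw [Matrix.transpose_add, Matrix.mul_add, Matrix.trace_add, hC X hX, hD Y hY, add_zero]

/-- The dual of the sum is the intersection of the duals; combine this with the dimension formula
for `C ⊔ A`. -/
lemma finrank_inf_add (C A : Code F n m) :
    finrank F (C ⊓ A : Code F n m) + m * n =
      finrank F C + finrank F A + finrank F (dual C ⊓ dual A : Code F n m) := by
  have h1 := Submodule.finrank_sup_add_finrank_inf_eq C A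
  have h2 := finrank_add_finrank_dual (C ⊔ A)
  rw [dual_sup] at h2
  omega

/-- Codes of total dimension exceeding `m * n` meet nontrivially. -/
lemma exists_mem_inf_ne_zero {C D : Code F n m} (h : m * n < finrank F C + finrank F D) :
    ∃ X ∈ C, X ∈ D ∧ X ≠ 0 := by
  have h1 := finrank_inf_add C D
  have : 0 < finrank F (C ⊓ D : Code F n m) := by omega
  obtain ⟨X, ⟨hC, hD⟩, hX⟩ := Submodule.exists_mem_ne_zero_of_ne_bot
    (fun hb => by rw [hb, finrank_bot] at this; exact this.false : C ⊓ D ≠ ⊥)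
  exact ⟨X, hC, hD, hX⟩

/-- Codes of complementary dimension meet nontrivially iff their duals do. -/
lemma exists_mem_inf_ne_zero_of_dual {C D : Code F n m}
    (h : m * n ≤ finrank F C + finrank F D) {X : Matrix (Fin n) (Fin m) F}
    (hC : X ∈ dual C) (hD : X ∈ dual D) (hX : X ≠ 0) :
    ∃ Y ∈ C, Y ∈ D ∧ Y ≠ 0 := by
  have h1 := finrank_inf_add C D
  have h2 : 0 < finrank F (dual C ⊓ dual D : Code F n m) :=
    Module.finrank_pos_iff_exists_ne_zero.2 ⟨⟨X, hC, hD⟩, fun h => hX (congrArg Subtype.val h)⟩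
  have : 0 < finrank F (C ⊓ D : Code F n m) := by omega
  obtain ⟨X, ⟨hC, hD⟩, hX⟩ := Submodule.exists_mem_ne_zero_of_ne_bot
    (fun hb => by rw [hb, finrank_bot] at this; exact this.false : C ⊓ D ≠ ⊥)
  exact ⟨X, hC, hD, hX⟩

end Dual

/-! ### Matrices with columns in a fixed subspace: the standard optimal anticodes. -/

section ColCode

/-- The matrices whose columns lie in `U`. -/
def colCode (m : ℕ) (U : Submodule F (Fin n → F)) : Code F n m where
  carrier := {X | ∀ j, X.transpose j ∈ U}
  add_mem' := fun hX hY j => U.add_mem (hX j) (hY j)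
  zero_mem' := fun _ => U.zero_mem
  smul_mem' := fun c _ hX j => U.smul_mem c (hX j)

lemma finrank_colCode (U : Submodule F (Fin n → F)) :
    finrank F (colCode m U) = m * finrank F U := by
  let e : colCode m U ≃ₗ[F] (Fin m → U) :=
    { toFun := fun X j => ⟨X.1.transpose j, X.2 j⟩
      invFun := fun f => ⟨fun i j => (f j).1 i, fun j => (f j).2⟩
      map_add' := fun _ _ => rfl
      map_smul' := fun _ _ => rfl
      left_inv := fun _ => rfl
      right_inv := fun _ => rfl }
  rw [e.finrank_eq, Module.finrank_pi_fintype]; simp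

lemma span_cols_le_iff {U : Submodule F (Fin n → F)} {X : Matrix (Fin n) (Fin m) F} :
    Submodule.span F (Set.range X.col) ≤ U ↔ X ∈ colCode m U := by
  rw [Submodule.span_le, Set.range_subset_iff]; rfl

lemma rank_le_of_mem_colCode {U : Submodule F (Fin n → F)} {X : Matrix (Fin n) (Fin m) F}
    (hX : X ∈ colCode m U) : X.rank ≤ finrank F U := by
  rw [Matrix.rank_eq_finrank_span_cols]
  exact Submodule.finrank_mono (span_cols_le_iff.2 hX)

lemma exists_le_finrank_eq {V : Type*} [AddCommGroup V] [Module F V] [FiniteDimensional F V]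
    (W : Submodule F V) {k : ℕ} (h1 : finrank F W ≤ k) (h2 : k ≤ finrank F V) :
    ∃ U, W ≤ U ∧ finrank F U = k := by
  induction k, h1 using Nat.le_induction with
  | base => exact ⟨W, le_rfl, rfl⟩
  | succ k hk ih =>
    obtain ⟨U, hU, hUk⟩ := ih (by omega)
    obtain ⟨x, hx⟩ : ∃ x, x ∉ U := by
      by_contra! hc
      rw [(Submodule.eq_top_iff'.2 hc : U = ⊤), finrank_top] at hUk
      omega
    exact ⟨U ⊔ F ∙ x, hU.trans le_sup_left, by
      rw [Submodule.finrank_sup_span_singleton hx, hUk]⟩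

lemma exists_mem_colCode {X : Matrix (Fin n) (Fin m) F} {k : ℕ} (h : X.rank ≤ k) (hk : k ≤ n) :
    ∃ U : Submodule F (Fin n → F), finrank F U = k ∧ X ∈ colCode m U := by
  rw [Matrix.rank_eq_finrank_span_cols] at h
  obtain ⟨U, hU, hUk⟩ := exists_le_finrank_eq _ h (by simpa using hk)
  exact ⟨U, hUk, span_cols_le_iff.1 hU⟩

lemma exists_finrank_eq {k : ℕ} (hk : k ≤ n) :
    ∃ U : Submodule F (Fin n → F), finrank F U = k := by
  obtain ⟨U, -, h⟩ := exists_le_finrank_eq (⊥ : Submodule F (Fin n → F)) (k := k) (by simp)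
    (by simpa using hk)
  exact ⟨U, h⟩

/-- The subspace `U'` is the orthogonal complement of `U` for the dot product: the trace form is the
sum of the dot products of corresponding columns. -/
lemma exists_dual_colCode (U : Submodule F (Fin n → F)) :
    ∃ U' : Submodule F (Fin n → F), finrank F U + finrank F U' = n ∧
      dual (colCode m U) = colCode m U' := by
  have hB : (Matrix.toBilin' (1 : Matrix (Fin n) (Fin n) F)).Nondegenerate :=
    LinearMap.BilinForm.nondegenerate_toBilin'_of_det_ne_zero' _ (by simp)
  have h := LinearMap.BilinForm.finrank_orthogonal hB U
  have h' := Submodule.finrank_le U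
  rw [Module.finrank_fin_fun] at h h'
  refine ⟨(Matrix.toBilin' (1 : Matrix (Fin n) (Fin n) F)).orthogonal U, by omega, ?_⟩
  refine (Submodule.eq_of_le_of_finrank_le (fun X hX Y hY => ?_) ?_).symm
  · have : ∀ j, Y.transpose j ⬝ᵥ X.transpose j = 0 := fun j => by
      have := hX j (Y.transpose j) (hY j)
      simpa [Matrix.toBilin'_apply'] using this
    rw [← Matrix.trace_transpose, Matrix.transpose_mul, Matrix.transpose_transpose,
      Matrix.trace_mul_comm]
    exact Finset.sum_eq_zero fun j _ => (dotProduct_comm _ _).trans (this j)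
  · have := finrank_add_finrank_dual (colCode m U)
    rw [finrank_colCode] at this ⊢
    rw [h, Nat.mul_sub]
    omega

end ColCode

/-! ### Linearized polynomials and Gabidulin codes. -/

section Gabidulin

variable (L : Type*) [Field L] [Algebra F L] [Fintype F]

/-- The `F`-linear map `x ↦ ∑ a_j x ^ (q ^ j)` of `L` attached to a linearized polynomial. -/
noncomputable def linearized {k : ℕ} (a : Fin k → L) : L →ₗ[F] L :=
  ∑ j, (a j) • ((FiniteField.frobeniusAlgHom F L) ^ (j : ℕ)).toLinearMap

variable {L}

lemma linearized_apply {k : ℕ} (a : Fin k → L) (x : L) :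
    linearized (F := F) L a x = ∑ j, a j * x ^ (Fintype.card F ^ (j : ℕ)) := by
  simp [linearized, AlgHom.coe_pow, FiniteField.coe_frobeniusAlgHom, pow_iterate]

/-- The kernel consists of roots of a nonzero polynomial of degree at most `q ^ (k - 1)`, and it has
`q ^ dim` elements. -/
lemma finrank_ker_linearized_lt [FiniteDimensional F L] {k : ℕ} {a : Fin k → L} (ha : a ≠ 0) :
    finrank F (LinearMap.ker (linearized (F := F) L a)) < k := by
  classical
  have hq : 1 < Fintype.card F := Fintype.one_lt_card
  obtain ⟨i, hi⟩ := Function.ne_iff.1 ha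
  let p : Polynomial L := ∑ j, Polynomial.C (a j) * Polynomial.X ^ (Fintype.card F ^ (j : ℕ))
  have hp : p ≠ 0 := fun h => by
    have := congrArg (Polynomial.coeff · (Fintype.card F ^ (i : ℕ))) h
    simp only [p, Polynomial.finsetSum_coeff, Polynomial.coeff_C_mul, Polynomial.coeff_X_pow,
      Polynomial.coeff_zero] at this
    rw [Finset.sum_eq_single i] at this
    · simp at this; exact hi this
    · intro j _ hj
      rw [if_neg, mul_zero]
      exact fun h => hj (Fin.ext (Nat.pow_right_injective hq h)).symm
    · simp
  have hdeg : p.natDegree ≤ Fintype.card F ^ (k - 1) := by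
    refine Polynomial.natDegree_sum_le_of_forall_le _ _ fun j _ => ?_
    refine (Polynomial.natDegree_C_mul_X_pow_le _ _).trans ?_
    exact Nat.pow_le_pow_right hq.le (by omega)
  have : Finite L := Module.finite_of_finite F
  have hker : Nat.card (LinearMap.ker (linearized (F := F) L a)) ≤ p.roots.toFinset.card := by
    rw [← Set.ncard_coe_finset]
    refine Set.ncard_le_ncard (fun x hx => ?_) (Finset.finite_toSet _)
    rw [SetLike.mem_coe, LinearMap.mem_ker, linearized_apply] at hx
    simpa [hp, p, Polynomial.eval_finsetSum] using hx
  have h1 := hker.trans ((Multiset.toFinset_card_le _).trans ((p.card_roots').trans hdeg))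
  rw [Module.natCard_eq_pow_finrank (K := F), Nat.card_eq_fintype_card] at h1
  have := (Nat.pow_le_pow_iff_right hq).1 h1
  have := i.2
  omega

end Gabidulin

/-- Gabidulin codes: for each `k ≤ n` there is a code of dimension `m * k` and minimum distance
`n - k + 1`, and these codes form a chain. -/
lemma exists_mrd_chain [Finite F] (hnm : n ≤ m) : ∃ D : ℕ → Code F n m, Monotone D ∧
    ∀ k ≤ n, finrank F (D k) = m * k ∧ ∀ X ∈ D k, X ≠ 0 → n < X.rank + k := by
  classical
  have := Fintype.ofFinite F
  rcases Nat.eq_zero_or_pos m with rfl | hm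
  · obtain rfl : n = 0 := by omega
    refine ⟨fun _ => ⊥, monotone_const, fun k _ => ⟨by simp, fun X _ hX => ?_⟩⟩
    exact absurd (Subsingleton.elim _ _) hX
  have : NeZero m := ⟨hm.ne'⟩
  obtain ⟨p, hp⟩ := CharP.exists F
  have : Fact p.Prime := ⟨CharP.char_is_prime F p⟩
  let L := FiniteField.Extension F p m
  have hL : finrank F L = m := FiniteField.finrank_extension F p m
  let b : Basis (Fin m) F L := finBasisOfFinrankEq F L hL
  -- Since `n ≤ m = [L : F]`, there is room for `n` independent evaluation points.
  let α : Fin n → L := fun i => b (Fin.castLE hnm i)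
  have hα : LinearIndependent F α := b.linearIndependent.comp _ (Fin.castLE_injective hnm)
  let G (k : ℕ) : (Fin k → L) →ₗ[F] Matrix (Fin n) (Fin m) F :=
    { toFun := fun a => Matrix.of fun i => b.equivFun (linearized (F := F) L a (α i))
      map_add' := fun a a' => by
        ext i j
        simp [linearized_apply, add_mul, Finset.sum_add_distrib]
      map_smul' := fun c a => by
        ext i j
        simp [linearized_apply, ← Finset.smul_sum] }
  have hG : ∀ k (a : Fin k → L) (v : Fin n → F),
      Matrix.vecMul v (G k a) = b.equivFun (linearized (F := F) L a (∑ i, v i • α i)) := by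
    intro k a v
    ext j
    simp [G, Matrix.vecMul, dotProduct, map_sum]
  -- By `hG`, the left kernel of the matrix embeds through the independent points `α` into the
  -- kernel of the linearized map, of dimension less than `k`.
  have hrank : ∀ k (a : Fin k → L), a ≠ 0 → n < (G k a).rank + k := by
    intro k a ha
    have h1 := (G k a).vecMulLinear.finrank_range_add_finrank_ker
    have h2 : finrank F (LinearMap.range (G k a).vecMulLinear) = (G k a).rank := by
      rw [← Matrix.rank_transpose, Matrix.rank, Matrix.mulVecLin_transpose]
    have h3 : finrank F (LinearMap.ker (G k a).vecMulLinear) ≤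
        finrank F (LinearMap.ker (linearized (F := F) L a)) := by
      let φ : (Fin n → F) →ₗ[F] L := Fintype.linearCombination F α
      have hφ : Function.Injective φ := hα.fintypeLinearCombination_injective
      refine LinearMap.finrank_le_finrank_of_injective
        (f := φ.restrict (fun v hv => ?_)) ?_
      · rw [LinearMap.mem_ker, Matrix.vecMulLinear_apply, hG] at hv
        exact b.equivFun.map_eq_zero_iff.1 hv
      · exact fun x y h => Subtype.ext (hφ (congrArg Subtype.val h))
    have h4 := finrank_ker_linearized_lt (F := F) ha
    rw [Module.finrank_fin_fun] at h1
    omega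
  refine ⟨fun k => LinearMap.range (G k), fun k l hkl => ?_, fun k hk => ⟨?_, ?_⟩⟩
  · rintro _ ⟨a, rfl⟩
    -- Padding the coefficients with zeros makes the codes a chain.
    refine ⟨fun j => if h : (j : ℕ) < k then a ⟨j, h⟩ else 0, ?_⟩
    ext i j
    refine congrFun (congrArg b.equivFun ?_) j
    rw [linearized_apply, linearized_apply]
    have e1 := Fin.sum_univ_eq_sum_range (fun j : ℕ => (if h : (j : ℕ) < k then a ⟨j, h⟩ else 0) *
      α i ^ (Fintype.card F ^ j))
    rw [e1 l, ← Finset.sum_subset (Finset.range_mono hkl), ← e1 k]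
    · exact Finset.sum_congr rfl fun j _ => by rw [dif_pos j.2]
    · intro x _ hx
      rw [dif_neg (by simpa using hx), zero_mul]
  · rw [LinearMap.finrank_range_of_inj]
    · rw [Module.finrank_pi_fintype]; simp [hL, mul_comm]
    · refine (injective_iff_map_eq_zero _).2 fun a ha => ?_
      by_contra h
      have := hrank k a h
      rw [ha, Matrix.rank_zero] at this
      omega
  · rintro _ ⟨a, rfl⟩ hX
    exact hrank k a fun h => hX (by rw [h, map_zero])

/-! ### Transitivity of rank isometries on matrices of given rank. -/

section Equivalence

/-- Choose `e` carrying `ker g` onto `ker f`; then `f ∘ e` and `g` have the same kernel, and `e'`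
extends the resulting isomorphism between their ranges. -/
lemma exists_linearEquiv_comp_eq {V W : Type*} [AddCommGroup V] [Module F V]
    [FiniteDimensional F V] [AddCommGroup W] [Module F W] [FiniteDimensional F W]
    (f g : V →ₗ[F] W) (h : finrank F (LinearMap.range f) = finrank F (LinearMap.range g)) :
    ∃ (e : V ≃ₗ[F] V) (e' : W ≃ₗ[F] W), g = e'.toLinearMap ∘ₗ f ∘ₗ e.toLinearMap := by
  have hf := f.finrank_range_add_finrank_ker
  have hg := g.finrank_range_add_finrank_ker
  obtain ⟨e, he⟩ := Submodule.exists_linearEquiv_restrict_eq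
    (LinearEquiv.ofFinrankEq (LinearMap.ker g) (LinearMap.ker f) (by omega))
  have hle : LinearMap.ker g ≤ LinearMap.ker (f ∘ₗ e.toLinearMap) := fun x hx => by
    rw [LinearMap.mem_ker, LinearMap.comp_apply, LinearEquiv.coe_coe, ← he ⟨x, hx⟩]
    exact (LinearEquiv.ofFinrankEq (LinearMap.ker g) (LinearMap.ker f) _ ⟨x, hx⟩).2
  have hr : finrank F (LinearMap.range (f ∘ₗ e.toLinearMap)) = finrank F (LinearMap.range f) := by
    rw [LinearMap.range_comp, LinearEquiv.range, Submodule.map_top]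
  have hk := (f ∘ₗ e.toLinearMap).finrank_range_add_finrank_ker
  have heq : LinearMap.ker g = LinearMap.ker (f ∘ₗ e.toLinearMap) :=
    Submodule.eq_of_le_of_finrank_eq hle (by omega)
  let φ := (f ∘ₗ e.toLinearMap).quotKerEquivRange.symm ≪≫ₗ
    Submodule.quotEquivOfEq _ _ heq.symm ≪≫ₗ g.quotKerEquivRange
  obtain ⟨e', he'⟩ := Submodule.exists_linearEquiv_restrict_eq φ
  refine ⟨e, e', LinearMap.ext fun v => ?_⟩
  have h1 := he' ⟨(f ∘ₗ e.toLinearMap) v, v, rfl⟩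
  have h2 : (f ∘ₗ e.toLinearMap).quotKerEquivRange.symm ⟨(f ∘ₗ e.toLinearMap) v, v, rfl⟩ =
      Submodule.Quotient.mk v := by
    rw [LinearEquiv.symm_apply_eq]; rfl
  simp only [φ, LinearEquiv.trans_apply, h2] at h1
  exact h1

/-- Matrices of the same rank correspond under a linear rank isometry. -/
lemma exists_isometry (M N : Matrix (Fin n) (Fin m) F) (h : M.rank = N.rank) :
    ∃ T : Matrix (Fin n) (Fin m) F ≃ₗ[F] Matrix (Fin n) (Fin m) F,
      T M = N ∧ ∀ X, (T X).rank = X.rank := by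
  obtain ⟨e, e', he⟩ := exists_linearEquiv_comp_eq (Matrix.toLin' M) (Matrix.toLin' N) h
  let T := Matrix.toLin' ≪≫ₗ LinearEquiv.arrowCongr e.symm e' ≪≫ₗ
    (Matrix.toLin' (R := F) (m := Fin n) (n := Fin m)).symm
  have hT : ∀ X, Matrix.toLin' (T X) = e'.toLinearMap ∘ₗ Matrix.toLin' X ∘ₗ e.toLinearMap :=
    fun X => by
      simp only [T, LinearEquiv.trans_apply, LinearEquiv.apply_symm_apply]
      rfl
  refine ⟨T, Matrix.toLin'.injective ((hT M).trans he.symm), fun X => ?_⟩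
  rw [Matrix.rank, Matrix.rank, ← Matrix.toLin'_apply', ← Matrix.toLin'_apply', hT,
    LinearMap.range_comp, LinearMap.range_comp, LinearEquiv.range, Submodule.map_top,
    LinearEquiv.finrank_map_eq]

end Equivalence

/-! ### Duals of MRD codes and of optimal anticodes. -/

section AnticodeDuality

/-- The dual of a linear MRD code is MRD. -/
lemma lt_rank_of_mem_dual {D : Code F n m} {k : ℕ} (hk : k ≤ n) (hD : finrank F D = m * k)
    (hd : ∀ X ∈ D, X ≠ 0 → n < X.rank + k) {Y : Matrix (Fin n) (Fin m) F} (hY : Y ∈ dual D)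
    (hY0 : Y ≠ 0) : k < Y.rank := by
  by_contra! h
  obtain ⟨U, hU, hYU⟩ := exists_mem_colCode h hk
  obtain ⟨U', hUU', hdual⟩ := exists_dual_colCode (m := m) U
  -- `D` and `colCode m U'` have complementary dimensions and their duals share `Y`, so they meet,
  -- in a matrix of rank at most `n - k`.
  obtain ⟨X, hXD, hXU, hX⟩ := exists_mem_inf_ne_zero_of_dual (C := D) (D := colCode m U') (X := Y)
    (by rw [hD, finrank_colCode, ← mul_add]; exact Nat.mul_le_mul_left _ (by omega)) hY
    (by rwa [← hdual, dual_dual]) hY0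
  have := hd X hXD hX
  have := rank_le_of_mem_colCode hXU
  omega

/-- Every matrix of rank greater than `n - k` lies in an MRD code of dimension `m * k`. -/
lemma exists_mrd_mem [Finite F] (hnm : n ≤ m) {k : ℕ} (hk : k ≤ n) {N : Matrix (Fin n) (Fin m) F}
    (hN : n < N.rank + k) :
    ∃ D : Code F n m, N ∈ D ∧ finrank F D = m * k ∧ ∀ X ∈ D, X ≠ 0 → n < X.rank + k := by
  obtain ⟨D, hmono, hD⟩ := exists_mrd_chain (F := F) hnm
  have hNn : N.rank ≤ n := (Matrix.rank_le_card_height N).trans (by simp)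
  -- The smaller chain member of index `n + 1 - N.rank` has nonzero ranks at least `N.rank`. By
  -- dimension it meets a `colCode` with ranks at most `N.rank`, so the rank is attained exactly.
  obtain ⟨M, hMD, hM⟩ : ∃ M ∈ D k, M.rank = N.rank := by
    rcases Nat.eq_zero_or_pos N.rank with h0 | h0
    · exact ⟨0, zero_mem _, by rw [h0, Matrix.rank_zero]⟩
    obtain ⟨U, hU⟩ := exists_finrank_eq (F := F) hNn
    have hl := hD (n + 1 - N.rank) (by omega)
    have hm : 0 < m := by omega
    obtain ⟨M, hMD, hMU, hM0⟩ := exists_mem_inf_ne_zero (C := D (n + 1 - N.rank))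
      (D := colCode m U) (by
        rw [hl.1, finrank_colCode, hU, ← mul_add]
        exact Nat.mul_lt_mul_of_pos_left (by omega) hm)
    have h1 := hl.2 M hMD hM0
    have h2 := rank_le_of_mem_colCode hMU
    exact ⟨M, hmono (by omega) hMD, by omega⟩
  obtain ⟨T, hT, hrank⟩ := exists_isometry M N hM
  refine ⟨(D k).map T.toLinearMap, ⟨M, hMD, hT⟩, ?_, ?_⟩
  · rw [LinearEquiv.finrank_map_eq, (hD k hk).1]
  · rintro _ ⟨X, hX, rfl⟩ h0
    rw [LinearEquiv.coe_coe, hrank]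
    exact (hD k hk).2 X hX fun h => h0 (by rw [h, map_zero])

/-- A code all of whose ranks are at most `s` has dimension at most `m * s`. -/
lemma finrank_le_of_rank_le [Finite F] (hnm : n ≤ m) {A : Code F n m} {s : ℕ}
    (hA : ∀ X ∈ A, X.rank ≤ s) : finrank F A ≤ m * s := by
  rcases le_total n s with hs | hs
  · have := Submodule.finrank_le A
    rw [finrank_space] at this
    exact this.trans (Nat.mul_le_mul_left _ hs)
  obtain ⟨D, -, hD⟩ := exists_mrd_chain (F := F) hnm
  have hDs := hD (n - s) (by omega)
  by_contra! h
  obtain ⟨X, hXA, hXD, hX⟩ := exists_mem_inf_ne_zero (C := A) (D := D (n - s)) (by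
    have : m * n = m * s + m * (n - s) := by rw [← mul_add]; congr 1; omega
    omega)
  have := hDs.2 X hXD hX
  have := hA X hXA
  omega

/-- The dual of an optimal anticode of maximum rank `s` has ranks at most `n - s`. -/
lemma rank_le_of_mem_dual [Finite F] (hnm : n ≤ m) {A : Code F n m} {s : ℕ} (hs : s ≤ n)
    (hdim : finrank F A = m * s) (hA : ∀ X ∈ A, X.rank ≤ s) {N : Matrix (Fin n) (Fin m) F}
    (hN : N ∈ dual A) : N.rank ≤ n - s := by
  by_contra! h
  -- Were the rank larger, `N` would lie in an MRD code `D` with `finrank F D = finrank F A`. Then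
  -- `N` lies in the duals of both `A` and `dual D`, which forces these to meet, although nonzero
  -- ranks in `dual D` exceed `s`.
  obtain ⟨D, hND, hD, hd⟩ := exists_mrd_mem hnm hs (N := N) (by omega)
  have hN0 : N ≠ 0 := by
    rintro rfl
    rw [Matrix.rank_zero] at h
    omega
  have hDD := finrank_add_finrank_dual D
  obtain ⟨X, hXA, hXD, hX⟩ := exists_mem_inf_ne_zero_of_dual (C := A) (D := dual D) (X := N)
    (by omega) hN (by rwa [dual_dual]) hN0
  have := lt_rank_of_mem_dual hs hD hd hXD hX
  have := hA X hXA
  omega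

end AnticodeDuality

/-! ### Leading positions and the ranks they force. -/

section Leading

/-- The row `i` and column `j` carry the first nonzero entry, in row-major order, of `X`. -/
def LeadsAt (X : Matrix (Fin n) (Fin m) F) (i : Fin n) (j : Fin m) : Prop :=
  X i j ≠ 0 ∧ (∀ i' < i, ∀ j', X i' j' = 0) ∧ ∀ j' < j, X i j' = 0

lemma exists_leadsAt {X : Matrix (Fin n) (Fin m) F} (hX : X ≠ 0) : ∃ i j, LeadsAt X i j := by
  classical
  have h1 : ∃ i, ∃ j, X i j ≠ 0 := by
    by_contra! h
    exact hX (Matrix.ext h)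
  obtain ⟨i, hi, hmin⟩ := WellFounded.has_min (wellFounded_lt (α := Fin n)) {i | ∃ j, X i j ≠ 0} h1
  obtain ⟨j, hj, hmin'⟩ := WellFounded.has_min (wellFounded_lt (α := Fin m)) {j | X i j ≠ 0} hi
  refine ⟨i, j, hj, fun i' hi' j' => ?_, fun j' hj' => ?_⟩
  · by_contra h; exact hmin i' ⟨j', h⟩ hi'
  · by_contra h; exact hmin' j' h hj'

open Classical in
/-- The leading positions of the elements of a code. -/
noncomputable def leadingPositions (A : Code F n m) : Finset (Fin n × Fin m) :=
  {p | ∃ X ∈ A, LeadsAt X p.1 p.2}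

lemma mem_leadingPositions {A : Code F n m} {p : Fin n × Fin m} :
    p ∈ leadingPositions A ↔ ∃ X ∈ A, LeadsAt X p.1 p.2 := by
  simp [leadingPositions]

/-- Reading off the entries at the leading positions is injective: a nonzero element does not vanish
at its own leading position. -/
lemma finrank_le_card_leadingPositions (A : Code F n m) :
    finrank F A ≤ (leadingPositions A).card := by
  let f : A →ₗ[F] (leadingPositions A → F) :=
    { toFun := fun X p => X.1 p.1.1 p.1.2
      map_add' := fun _ _ => rfl
      map_smul' := fun _ _ => rfl }
  have hf : Function.Injective f := by
    refine (injective_iff_map_eq_zero f).2 fun X hX => ?_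
    by_contra h
    obtain ⟨i, j, hij⟩ := exists_leadsAt (fun h' => h (Subtype.ext h') : X.1 ≠ 0)
    exact hij.1 (congrFun hX ⟨(i, j), mem_leadingPositions.2 ⟨X, X.2, hij⟩⟩)
  simpa using LinearMap.finrank_le_finrank_of_injective hf

/-- In a relation, look at the smallest leading column among the vectors with nonzero coefficient:
only one of them is nonzero there. -/
lemma linearIndependent_of_leading {ι : Type*} {v : ι → Fin m → F} {c : ι → Fin m}
    (hc : Function.Injective c) (h1 : ∀ i, v i (c i) ≠ 0) (h2 : ∀ i, ∀ j < c i, v i j = 0) :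
    LinearIndependent F v := by
  classical
  rw [linearIndependent_iff']
  intro s g hg
  by_contra! hne
  obtain ⟨i, hi, hmin⟩ := (s.filter (g · ≠ 0)).exists_min_image c
    (by obtain ⟨i, hi, h⟩ := hne; exact ⟨i, Finset.mem_filter.2 ⟨hi, h⟩⟩)
  rw [Finset.mem_filter] at hi
  have := congrFun hg (c i)
  rw [Finset.sum_apply, Finset.sum_eq_single i] at this
  · simp [hi.2, h1 i] at this
  · intro j hj hji
    by_cases hgj : g j = 0
    · simp [hgj]
    · have hlt : c i < c j := lt_of_le_of_ne (hmin j (Finset.mem_filter.2 ⟨hj, hgj⟩))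
        fun h => hji (hc h).symm
      simp [h2 j _ hlt]
  · exact fun h => absurd hi.1 h

/-- If `z` and `z + v i` both lay in the span of the other vectors, so would `v i`. -/
lemma linearIndependent_update_or {ι V : Type*} [DecidableEq ι] [AddCommGroup V] [Module F V]
    {v : ι → V} (hv : LinearIndependent F v) (i : ι) (z : V) :
    LinearIndependent F (Function.update v i z) ∨
      LinearIndependent F (Function.update v i (z + v i)) := by
  have hu : ∀ w, LinearIndependent F (Function.update v i w) ↔
      LinearIndepOn F v {i}ᶜ ∧ w ∉ Submodule.span F (v '' {i}ᶜ) := fun w => by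
    have heq : Set.EqOn (Function.update v i w) v {i}ᶜ := fun j hj => Function.update_of_ne hj _ _
    have huniv : insert i {i}ᶜ = (Set.univ : Set ι) := by
      rw [Set.insert_eq, Set.union_compl_self]
    rw [← linearIndepOn_univ_iff, ← huniv, linearIndepOn_insert (by simp), Function.update_self,
      heq.image_eq, linearIndepOn_congr heq]
  have hi := (hu (v i)).1 (by rwa [Function.update_eq_self])
  by_contra! h
  rw [hu, hu] at h
  have h1 : z ∈ Submodule.span F (v '' {i}ᶜ) := by
    by_contra hz; exact h.1 ⟨hi.1, hz⟩
  have h2 : z + v i ∈ Submodule.span F (v '' {i}ᶜ) := by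
    by_contra hz; exact h.2 ⟨hi.1, hz⟩
  exact hi.2 ((Submodule.add_mem_iff_right _ h1).1 h2)

/-- A partial matching inside the leading positions forces an element of large rank. -/
lemma exists_rank_ge_of_matching {A : Code F n m} {R : Finset (Fin n)} {c : R → Fin m}
    (hc : Function.Injective c) (h : ∀ r : R, (r.1, c r) ∈ leadingPositions A) :
    ∃ Y ∈ A, R.card ≤ Y.rank := by
  classical
  simp only [mem_leadingPositions] at h
  choose X hXA hX using h
  -- Leading rows are replaced from the top down by the rows of a single element `Y`. At row `t`,
  -- either `Y` or `Y + X r₀` keeps independence, and adding `X r₀` leaves the rows above `t`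
  -- unchanged because it vanishes there.
  have key : ∀ t ≤ n, ∃ Y ∈ A, LinearIndependent F
      (fun r : R => if (r.1 : ℕ) < t then Y r.1 else X r r.1) := by
    intro t
    induction t with
    | zero =>
      exact fun _ => ⟨0, A.zero_mem, by
        simpa using linearIndependent_of_leading hc (fun r => (hX r).1) fun r => (hX r).2.2⟩
    | succ t ih =>
      intro ht
      obtain ⟨Y, hYA, hY⟩ := ih (by omega)
      by_cases htR : (⟨t, ht⟩ : Fin n) ∈ R
      · let r₀ : R := ⟨⟨t, ht⟩, htR⟩
        have hup : ∀ Z : Matrix (Fin n) (Fin m) F, (∀ i : Fin n, (i : ℕ) < t → Z i = Y i) →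
            (fun r : R => if (r.1 : ℕ) < t + 1 then Z r.1 else X r r.1) =
            Function.update (fun r : R => if (r.1 : ℕ) < t then Y r.1 else X r r.1) r₀
              (Z ⟨t, ht⟩) := by
          intro Z hZ
          funext r
          by_cases hr : r = r₀
          · subst hr; simp [r₀]
          · have hne : (r.1 : ℕ) ≠ t := fun h => hr (Subtype.ext (Fin.ext h))
            rw [Function.update_of_ne hr]
            by_cases hlt : (r.1 : ℕ) < t
            · rw [if_pos hlt, if_pos (by omega), hZ _ hlt]
            · rw [if_neg hlt, if_neg (by omega)]
        rcases linearIndependent_update_or hY r₀ (Y ⟨t, ht⟩) with h | h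
        · exact ⟨Y, hYA, by rwa [hup Y fun _ _ => rfl]⟩
        · refine ⟨Y + X r₀, A.add_mem hYA (hXA r₀), ?_⟩
          rw [hup]
          · rw [if_neg (lt_irrefl t)] at h
            exact h
          · intro i hi
            funext j
            simp [(hX r₀).2.1 i hi j]
      · refine ⟨Y, hYA, ?_⟩
        convert hY using 2 with r
        have hne : (r.1 : ℕ) ≠ t := fun h => htR (by
          have : (⟨t, ht⟩ : Fin n) = r.1 := Fin.ext h.symm
          rw [this]; exact r.2)
        exact if_congr (by omega) rfl rfl
  obtain ⟨Y, hYA, hY⟩ := key n le_rfl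
  refine ⟨Y, hYA, ?_⟩
  have hrow : LinearIndependent F (Y.submatrix (fun r : R => r.1) id).row := by
    convert hY using 2 with r
    rw [if_pos r.1.2]; rfl
  have := hrow.rank_matrix
  rw [Fintype.card_coe] at this
  exact this ▸ Matrix.rank_submatrix_le _ _ _

end Leading

/-! ### Extending optimal anticodes. -/

section Extension

/-- A set of at least `m * s` positions in an `n × m` grid, `s < n ≤ m`, without a partial matching
of size `s + 1`, misses a row, or a column if the grid is square. -/
lemma exists_missed_line (hnm : n ≤ m) {P : Finset (Fin n × Fin m)} {s : ℕ} (hs : s < n)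
    (hmatch : ∀ (R : Finset (Fin n)) (c : R → Fin m), Function.Injective c →
      (∀ r : R, (r.1, c r) ∈ P) → R.card ≤ s) (hP : m * s ≤ P.card) :
    (∃ i, ∀ j, (i, j) ∉ P) ∨ (n = m ∧ ∃ j, ∀ i, (i, j) ∉ P) := by
  classical
  let T : Fin n → Finset (Fin m) := fun i => {j | (i, j) ∈ P}
  have hT : ∀ i j, j ∈ T i ↔ (i, j) ∈ P := by simp [T]
  -- Hall's theorem with `n - s - 1` dummy columns: otherwise all rows could be matched, at least `s
  -- + 1` of them to genuine columns.
  obtain ⟨S, hS⟩ : ∃ S : Finset (Fin n), (S.biUnion T).card + (n - s - 1) < S.card := by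
    by_contra! hno
    let t : Fin n → Finset (Fin m ⊕ Fin (n - s - 1)) := fun i => (T i).disjSum Finset.univ
    obtain ⟨f, hf, hft⟩ := (Finset.all_card_le_biUnion_card_iff_exists_injective t).1 fun S => by
      rcases S.eq_empty_or_nonempty with rfl | ⟨i, hi⟩
      · simp
      refine (hno S).trans ?_
      have hsub : (S.biUnion T).disjSum (Finset.univ : Finset (Fin (n - s - 1))) ⊆
          S.biUnion t := by
        rintro (x | x) hx
        · obtain ⟨a, ha, hxa⟩ := Finset.mem_biUnion.1 (Finset.inl_mem_disjSum.1 hx)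
          exact Finset.mem_biUnion.2 ⟨a, ha, Finset.inl_mem_disjSum.2 hxa⟩
        · exact Finset.mem_biUnion.2 ⟨i, hi, Finset.inr_mem_disjSum.2 (Finset.mem_univ _)⟩
      simpa using Finset.card_le_card hsub
    let R : Finset (Fin n) := {i | (f i).isLeft}
    have hR : ∀ r : R, (f r.1).isLeft := fun r => (Finset.mem_filter.1 r.2).2
    have h1 := hmatch R (fun r => (f r.1).getLeft (hR r))
      (fun r r' h => by
        have e : f r.1 = f r'.1 := by
          rw [← Sum.inl_getLeft _ (hR r), ← Sum.inl_getLeft _ (hR r')]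
          exact congrArg Sum.inl h
        exact Subtype.ext (hf e))
      (fun r => by
        have := hft r.1
        rw [← Sum.inl_getLeft _ (hR r), Finset.inl_mem_disjSum, hT] at this
        exact this)
    have h2 : Rᶜ.card ≤ n - s - 1 := by
      have hR' : ∀ r : (Rᶜ : Finset (Fin n)), (f r.1).isRight := fun r => by
        simpa [R] using r.2
      have hinj : Function.Injective
          (fun r : (Rᶜ : Finset (Fin n)) => (f r.1).getRight (hR' r)) := fun r r' h => by
        have e : f r.1 = f r'.1 := by
          rw [← Sum.inr_getRight _ (hR' r), ← Sum.inr_getRight _ (hR' r')]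
          exact congrArg Sum.inr h
        exact Subtype.ext (hf e)
      have := Fintype.card_le_of_injective _ hinj
      rwa [Fintype.card_coe, Fintype.card_fin] at this
    have h3 := R.card_add_card_compl
    rw [Fintype.card_fin] at h3
    omega
  by_contra! hcon
  obtain ⟨hrow, hcol⟩ := hcon
  have hSn : S.card ≤ n := by simpa using S.card_le_univ
  have hsub : P ⊆ Sᶜ ×ˢ Finset.univ ∪ S ×ˢ S.biUnion T := by
    rintro ⟨i, j⟩ h
    by_cases hi : i ∈ S
    · exact Finset.mem_union_right _ (Finset.mem_product.2
        ⟨hi, Finset.mem_biUnion.2 ⟨i, hi, (hT i j).2 h⟩⟩)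
    · exact Finset.mem_union_left _ (by simpa using hi)
  have hcard := hP.trans ((Finset.card_le_card hsub).trans (Finset.card_union_le _ _))
  rw [Finset.card_product, Finset.card_product, Finset.card_compl, Finset.card_univ,
    Fintype.card_fin, Fintype.card_fin] at hcard
  have hT0 : 0 < (S.biUnion T).card := by
    obtain ⟨i, hi⟩ := Finset.card_pos.1 (by omega : 0 < S.card)
    obtain ⟨j, hj⟩ := hrow i
    exact Finset.card_pos.2 ⟨j, Finset.mem_biUnion.2 ⟨i, hi, (hT i j).2 hj⟩⟩
  -- With `b` the number of columns met by the rows in `S`, the choice of `S` gives `m * (n - |S| +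
  -- b) ≤ m * s`, while `hcard` bounds `m * s` by `(n - |S|) * m + |S| * b`. Thus `m * b ≤ |S| * b`,
  -- which forces `|S| = n = m`; a column outside the union is then missed by every row.
  have hmS : m ≤ S.card := by
    refine Nat.le_of_mul_le_mul_right (c := (S.biUnion T).card) ?_ hT0
    have : m * (n - S.card + (S.biUnion T).card) ≤ m * s := Nat.mul_le_mul_left _ (by omega)
    rw [mul_add, mul_comm m (n - _)] at this
    omega
  obtain ⟨j, hj⟩ : ∃ j, j ∉ S.biUnion T := by
    by_contra! hall
    have := Finset.card_le_card (fun j _ => hall j : Finset.univ ⊆ S.biUnion T)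
    rw [Finset.card_univ, Fintype.card_fin] at this
    omega
  obtain ⟨i, hi⟩ := hcol (by omega) j
  have hiS : i ∈ S := by
    have : S = Finset.univ := Finset.eq_univ_of_card _ (by rw [Fintype.card_fin]; omega)
    rw [this]; exact Finset.mem_univ _
  exact hj (Finset.mem_biUnion.2 ⟨i, hiS, (hT i j).2 hi⟩)

lemma rank_add_le_add (X Y : Matrix (Fin n) (Fin m) F) : (X + Y).rank ≤ X.rank + Y.rank := by
  rw [Matrix.rank, Matrix.mulVecLin_add]
  exact (Submodule.finrank_mono (LinearMap.range_add_le _ _)).trans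
    (Submodule.finrank_add_le_finrank_add_finrank _ _)

/-- An optimal anticode of maximum rank `s < n` extends to one of maximum rank `s + 1`. -/
lemma exists_anticode_succ (hnm : n ≤ m) {A : Code F n m} {s : ℕ} (hs : s < n)
    (hdim : finrank F A = m * s) (hA : ∀ X ∈ A, X.rank ≤ s) :
    ∃ A' : Code F n m, A ≤ A' ∧ finrank F A' = m * (s + 1) ∧ ∀ X ∈ A', X.rank ≤ s + 1 := by
  -- `B` is the space of matrices supported on the missed row or column. Their leading positions lie
  -- on that line, where `A` has none, so `A ⊓ B = ⊥`.
  obtain ⟨B, hB, hB1, hAB⟩ : ∃ B : Code F n m, finrank F B = m ∧ (∀ X ∈ B, X.rank ≤ 1) ∧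
      A ⊓ B = ⊥ := by
    have hline : ∀ {l : ℕ} (i : Fin l),
        finrank F (F ∙ (Pi.single i 1 : Fin l → F)) = 1 :=
      fun i => finrank_span_singleton (by simp)
    have hzero : ∀ {l : ℕ} {i i' : Fin l} {v : Fin l → F},
        v ∈ F ∙ (Pi.single i 1 : Fin l → F) → i' ≠ i → v i' = 0 := by
      rintro l i i' v hv hi
      obtain ⟨a, rfl⟩ := Submodule.mem_span_singleton.1 hv
      simp [hi]
    rcases exists_missed_line hnm hs
      (fun R c hc h => by
        obtain ⟨Y, hY, hYR⟩ := exists_rank_ge_of_matching hc h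
        exact hYR.trans (hA Y hY))
      (hdim ▸ finrank_le_card_leadingPositions A) with ⟨i, hi⟩ | ⟨rfl, j, hj⟩
    · refine ⟨colCode m (F ∙ Pi.single i 1), by rw [finrank_colCode, hline, mul_one],
        fun X hX => (rank_le_of_mem_colCode hX).trans (hline i).le, ?_⟩
      refine (Submodule.eq_bot_iff _).2 fun X hX => ?_
      by_contra h0
      obtain ⟨i', j', h⟩ := exists_leadsAt h0
      by_cases hii : i' = i
      · subst hii
        exact hi j' (mem_leadingPositions.2 ⟨X, hX.1, h⟩)
      · exact h.1 (hzero (v := X.transpose j') (hX.2 j') hii)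
    · refine ⟨(colCode n (F ∙ Pi.single j 1)).map
        (Matrix.transposeLinearEquiv (Fin n) (Fin n) F F).toLinearMap,
        by rw [LinearEquiv.finrank_map_eq, finrank_colCode, hline, mul_one], ?_, ?_⟩
      · rintro _ ⟨X, hX, rfl⟩
        exact (Matrix.rank_transpose X).trans_le
          ((rank_le_of_mem_colCode hX).trans (hline j).le)
      refine (Submodule.eq_bot_iff _).2 ?_
      rintro _ ⟨hXA, X, hX, rfl⟩
      by_contra h0
      obtain ⟨i', j', h⟩ := exists_leadsAt h0
      by_cases hjj : j' = j
      · subst hjj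
        exact hj i' (mem_leadingPositions.2 ⟨_, hXA, h⟩)
      · exact h.1 (hzero (v := X.transpose i') (hX i') hjj)
  refine ⟨A ⊔ B, le_sup_left, ?_, ?_⟩
  · have := Submodule.finrank_sup_add_finrank_inf_eq A B
    rw [hAB, finrank_bot, hB, hdim] at this
    rw [mul_add]
    omega
  · intro Z hZ
    obtain ⟨X, hX, Y, hY, rfl⟩ := Submodule.mem_sup.1 hZ
    exact (rank_add_le_add X Y).trans (add_le_add (hA X hX) (hB1 Y hY))

lemma exists_anticode_extension (hnm : n ≤ m) {A : Code F n m} {s s' : ℕ} (hss' : s ≤ s')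
    (hs' : s' ≤ n) (hdim : finrank F A = m * s) (hA : ∀ X ∈ A, X.rank ≤ s) :
    ∃ A' : Code F n m, A ≤ A' ∧ finrank F A' = m * s' ∧ ∀ X ∈ A', X.rank ≤ s' := by
  induction s', hss' using Nat.le_induction with
  | base => exact ⟨A, le_rfl, hdim, hA⟩
  | succ k hk ih =>
    obtain ⟨A₁, h1, h2, h3⟩ := ih (by omega)
    obtain ⟨A₂, h4, h5, h6⟩ := exists_anticode_succ hnm (by omega) h2 h3
    exact ⟨A₂, h1.trans h4, h5, h6⟩

end Extension

/-! ### Generalized weights and the minimum distance of the dual. -/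

section Weights

lemma rank_le_maxrk {A : Code F n m} {X : Matrix (Fin n) (Fin m) F} (hX : X ∈ A) :
    X.rank ≤ maxrk A := by
  refine le_csSup ⟨n, ?_⟩ ⟨X, hX, rfl⟩
  rintro _ ⟨Y, -, rfl⟩
  exact (Matrix.rank_le_card_height Y).trans (by simp)

lemma maxrk_le {A : Code F n m} {s : ℕ} (h : ∀ X ∈ A, X.rank ≤ s) : maxrk A ≤ s := by
  refine csSup_le ⟨_, 0, A.zero_mem, rfl⟩ ?_
  rintro _ ⟨Y, hY, rfl⟩
  exact h Y hY

/-- Dimension `m * s` rules out a maximum rank below `s`, so `A` is an optimal anticode with `maxrk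
A = s`. -/
lemma genWeight_le [Finite F] (hnm : n ≤ m) (hm : 0 < m) {C A : Code F n m} {r s : ℕ}
    (hdim : finrank F A = m * s) (hA : ∀ X ∈ A, X.rank ≤ s)
    (hr : r ≤ finrank F (C ⊓ A : Code F n m)) : genWeight C r ≤ s := by
  have h1 : m * s ≤ m * maxrk A := hdim ▸ finrank_le_of_rank_le hnm fun X hX => rank_le_maxrk hX
  have h2 : maxrk A = s := le_antisymm (maxrk_le hA) (Nat.le_of_mul_le_mul_left h1 hm)
  exact Nat.sInf_le ⟨A, by rw [IsOptimalAnticode, h2, hdim], hr, h2⟩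

/-- A column space of dimension `n - k + i` gives an anticode meeting `C` in dimension at least `m *
i ≥ 1 + (i - 1) * m`. -/
lemma genWeight_le_singleton [Finite F] (hnm : n ≤ m) (hm : 0 < m) {C : Code F n m} {k i : ℕ}
    (hC : finrank F C = m * k) (hkn : k ≤ n) (hi : 1 ≤ i) (hik : i ≤ k) :
    genWeight C (1 + (i - 1) * m) ≤ n - k + i := by
  obtain ⟨U, hU⟩ := exists_finrank_eq (F := F) (n := n) (k := n - k + i) (by omega)
  refine genWeight_le hnm hm (A := colCode m U) (by rw [finrank_colCode, hU])
    (fun X hX => hU ▸ rank_le_of_mem_colCode hX) ?_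
  have h := finrank_inf_add C (colCode m U)
  have e1 : m * k + m * (n - k + i) = m * n + m * i := by
    rw [← mul_add, ← mul_add]; congr 1; omega
  have e2 : m * i = (i - 1) * m + m := by
    obtain ⟨i, rfl⟩ := Nat.exists_eq_add_of_le' hi
    simp [mul_add, mul_comm]
  rw [finrank_colCode, hU, hC] at h
  omega

/-- The generalized weights of `C` at indices `1 + (i - 1) m` detect low rank codewords of the dual
code. -/
lemma genWeight_lt_iff [Finite F] (hnm : n ≤ m) (hm : 0 < m) {C : Code F n m} {k i : ℕ}
    (hC : finrank F C = m * k) (hkn : k ≤ n) (hi : 1 ≤ i) (hik : i ≤ k) :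
    genWeight C (1 + (i - 1) * m) < n - k + i ↔
      ∃ X ∈ dual C, X ≠ 0 ∧ X.rank ≤ k - i + 1 := by
  have e1 : m * k + m * (n - k + i - 1) = m * n + (i - 1) * m := by
    rw [mul_comm (i - 1), ← mul_add, ← mul_add]; congr 1; omega
  constructor
  · intro h
    -- Nonemptiness is needed because `sInf ∅ = 0` would satisfy the inequality vacuously; the full
    -- matrix space is a witness.
    have hne : {w | ∃ A : Code F n m, IsOptimalAnticode A ∧
        1 + (i - 1) * m ≤ finrank F (C ⊓ A : Code F n m) ∧ maxrk A = w}.Nonempty := by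
      refine ⟨_, ⊤, ?_, ?_, rfl⟩
      · rw [IsOptimalAnticode]
        refine le_antisymm (finrank_le_of_rank_le hnm fun X hX => rank_le_maxrk hX) ?_
        rw [finrank_top, finrank_space]
        exact Nat.mul_le_mul_left _
          (maxrk_le fun X _ => (Matrix.rank_le_card_height X).trans (by simp))
      · have e2 : m * k = (i - 1) * m + m * (k - i + 1) := by
          rw [mul_comm (i - 1), ← mul_add]; congr 1; omega
        have e3 : m * 1 ≤ m * (k - i + 1) := Nat.mul_le_mul_left _ (by omega)
        rw [inf_top_eq, hC]
        omega
    obtain ⟨A, hopt, hr, hw⟩ := Nat.sInf_mem hne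
    change maxrk A = genWeight C (1 + (i - 1) * m) at hw
    obtain ⟨A', hAA', hdim, hA'⟩ := exists_anticode_extension hnm (s' := n - k + i - 1)
      (by omega) (by omega) hopt fun X hX => rank_le_maxrk hX
    have h1 : finrank F (C ⊓ A : Code F n m) ≤ finrank F (C ⊓ A' : Code F n m) :=
      Submodule.finrank_mono (inf_le_inf_left C hAA')
    have h2 := finrank_inf_add C A'
    have h3 : 0 < finrank F (dual C ⊓ dual A' : Code F n m) := by
      rw [hC, hdim] at h2; omega
    obtain ⟨⟨X, hXC, hXA⟩, hX⟩ := Module.finrank_pos_iff_exists_ne_zero.1 h3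
    refine ⟨X, hXC, fun h => hX (Subtype.ext h), ?_⟩
    have := rank_le_of_mem_dual hnm (by omega) hdim hA' hXA
    omega
  · rintro ⟨X, hXC, hX0, hX⟩
    obtain ⟨U, hU, hXU⟩ := exists_mem_colCode hX (by omega)
    obtain ⟨U', hUU', hdual⟩ := exists_dual_colCode (m := m) U
    have hU' : finrank F U' = n - k + i - 1 := by omega
    have h := finrank_inf_add C (colCode m U')
    have h3 : 0 < finrank F (dual C ⊓ dual (colCode m U') : Code F n m) :=
      Module.finrank_pos_iff_exists_ne_zero.2
        ⟨⟨X, hXC, by rwa [← hdual, dual_dual]⟩, fun h => hX0 (congrArg Subtype.val h)⟩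
    have := genWeight_le hnm hm (C := C) (A := colCode m U') (r := 1 + (i - 1) * m)
      (by rw [finrank_colCode, hU']) (fun X hX => hU' ▸ rank_le_of_mem_colCode hX)
      (by rw [finrank_colCode, hU', hC] at h; omega)
    omega

lemma minDist_le_iff {C : Code F n m} (hC : C ≠ ⊥) {d : ℕ} :
    minDist C ≤ d ↔ ∃ X ∈ C, X ≠ 0 ∧ X.rank ≤ d := by
  obtain ⟨Y, hY, hY0⟩ := Submodule.exists_mem_ne_zero_of_ne_bot hC
  constructor
  · intro h
    obtain ⟨X, hX, hX0, hr⟩ := Nat.sInf_mem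
      (⟨_, Y, hY, hY0, rfl⟩ : {d | ∃ A ∈ C, A ≠ 0 ∧ A.rank = d}.Nonempty)
    exact ⟨X, hX, hX0, hr.trans_le h⟩
  · rintro ⟨X, hX, hX0, hr⟩
    exact (Nat.sInf_le ⟨X, hX, hX0, rfl⟩ : minDist C ≤ X.rank).trans hr

lemma minDist_pos {C : Code F n m} (hC : C ≠ ⊥) : 0 < minDist C := by
  by_contra! h
  obtain ⟨X, -, hX0, hr⟩ := (minDist_le_iff hC).1 h
  obtain ⟨U, hU, hXU⟩ := exists_mem_colCode hr (Nat.zero_le _)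
  refine hX0 (Matrix.ext fun i j => ?_)
  have := hXU j
  rw [Submodule.finrank_eq_zero.1 hU] at this
  exact congrFun ((Submodule.mem_bot F).1 this) i

lemma minDist_le_singleton {C : Code F n m} {k : ℕ} (hm : 0 < m) (hC : finrank F C = m * (n - k))
    (hk : k < n) : minDist C ≤ k + 1 := by
  obtain ⟨U, hU⟩ := exists_finrank_eq (F := F) (n := n) (k := k + 1) hk
  obtain ⟨X, hXC, hXU, hX⟩ := exists_mem_inf_ne_zero (C := C) (D := colCode m U) (by
    rw [hC, finrank_colCode, hU, ← mul_add]
    exact Nat.mul_lt_mul_of_pos_left (by omega) hm)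
  exact (Nat.sInf_le ⟨X, hXC, hX, rfl⟩ : minDist C ≤ X.rank).trans
    (hU ▸ rank_le_of_mem_colCode hXU)

lemma genWeight_eq_iff [Finite F] (hnm : n ≤ m) (hm : 0 < m) {C : Code F n m} {k i : ℕ}
    (hC : finrank F C = m * k) (hkn : k ≤ n) (hdual : dual C ≠ ⊥) (hi : 1 ≤ i) (hik : i ≤ k) :
    genWeight C (1 + (i - 1) * m) = n - k + i ↔ k - i + 1 < minDist (dual C) := by
  have h1 := genWeight_le_singleton hnm hm hC hkn hi hik
  have h2 := genWeight_lt_iff hnm hm hC hkn hi hik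
  rw [← minDist_le_iff hdual] at h2
  omega

lemma isIMRD_iff [Finite F] (hnm : n ≤ m) (hm : 0 < m) {C : Code F n m} {k i : ℕ}
    (hC : finrank F C = m * k) (hkn : k ≤ n) (hdual : dual C ≠ ⊥) :
    IsIMRD C i ↔ 1 ≤ i ∧ i ≤ k ∧ k - i + 1 < minDist (dual C) := by
  have hm' : (0 : ℚ) < m := by exact_mod_cast hm
  have hceil : ⌈(finrank F C : ℚ) / (m : ℚ)⌉₊ = k := by
    rw [hC, Nat.cast_mul, mul_div_cancel_left₀ _ hm'.ne', Nat.ceil_natCast]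
  rw [IsIMRD, hceil]
  refine and_congr_right fun hi => and_congr_right fun hik => ?_
  -- The quotient is `k - i + (m - 1) / m`.
  have hfloor : ⌊((finrank F C : ℚ) - ((1 + (i - 1) * m : ℕ) : ℚ)) / (m : ℚ)⌋ = (k : ℤ) - i := by
    have h1 : (1 : ℚ) ≤ m := by exact_mod_cast hm
    rw [hC, Int.floor_eq_iff, le_div_iff₀ hm', div_lt_iff₀ hm']
    push_cast [Nat.cast_sub hi]
    constructor <;> nlinarith
  rw [hfloor, ← genWeight_eq_iff hnm hm hC hkn hdual hi hik]
  omega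

end Weights

end RankMetric

/-! ### The main theorem. -/

theorem mainTheorem5 {F : Type*} [Field F] [Finite F] {n m : ℕ} (hnm : n ≤ m)
    (C : RankMetric.Code F n m) (hC_bot : C ≠ ⊥) (hC_top : C ≠ ⊤)
    (t : ℕ) (ht : Module.finrank F C = t) (hmt : m ∣ t) :
    (RankMetric.genWeight C (1 + (⌈(t : ℚ) / (m : ℚ)⌉₊ - 1) * m) = n →
      ∀ i : ℕ, RankMetric.IsIMRDOfDegreePred C i ↔
        RankMetric.rdef (RankMetric.dual C) = (i : ℤ) - 1) ∧
    (RankMetric.genWeight C (1 + (⌈(t : ℚ) / (m : ℚ)⌉₊ - 1) * m) < n ↔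
      (RankMetric.rdef (RankMetric.dual C) : ℚ) = (t : ℚ) / (m : ℚ)) := by
  obtain ⟨k, rfl⟩ := hmt
  have hspace := RankMetric.finrank_space (F := F) (n := n) (m := m)
  have hpos : 0 < Module.finrank F C :=
    Nat.pos_of_ne_zero fun h => hC_bot (Submodule.finrank_eq_zero.1 h)
  have hlt : m * k < m * n := by
    rw [← ht, ← hspace]
    exact Submodule.finrank_lt hC_top
  have hm : 0 < m := Nat.pos_of_mul_pos_right (ht ▸ hpos)
  have hk : 0 < k := Nat.pos_of_mul_pos_left (ht ▸ hpos)
  have hkn : k < n := Nat.lt_of_mul_lt_mul_left hlt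
  have hdim : Module.finrank F (RankMetric.dual C) = m * (n - k) := by
    have := RankMetric.finrank_add_finrank_dual C
    rw [Nat.mul_sub]
    omega
  have hdual : RankMetric.dual C ≠ ⊥ := fun h => by
    rw [h, finrank_bot, Nat.mul_sub] at hdim
    omega
  have hm' : (m : ℚ) ≠ 0 := by exact_mod_cast hm.ne'
  have hdiv : ((m * k : ℕ) : ℚ) / (m : ℚ) = k := by
    rw [Nat.cast_mul, mul_div_cancel_left₀ _ hm']
  have hceil : ⌈((m * k : ℕ) : ℚ) / (m : ℚ)⌉₊ = k := by rw [hdiv, Nat.ceil_natCast]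
  have hrdef : RankMetric.rdef (RankMetric.dual C) =
      (k : ℤ) + 1 - RankMetric.minDist (RankMetric.dual C) := by
    rw [RankMetric.rdef, hdim, Nat.cast_mul, mul_div_cancel_left₀ _ hm', Int.ceil_natCast]
    omega
  have hd1 := RankMetric.minDist_pos hdual
  have hd2 := RankMetric.minDist_le_singleton hm hdim hkn
  have hle := RankMetric.genWeight_le_singleton hnm hm ht hkn.le hk le_rfl
  have heq := RankMetric.genWeight_eq_iff hnm hm ht hkn.le hdual hk le_rfl
  have hMRD := fun i => RankMetric.isIMRD_iff (i := i) hnm hm ht hkn.le hdual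
  rw [hceil, hdiv, hrdef]
  constructor
  · intro hn i
    have hd : 1 < RankMetric.minDist (RankMetric.dual C) := by omega
    -- The subtraction does not truncate: the distance is at most `k + 1`, so this index is at least
    -- `1`, and `hd` makes it at most `k`.
    have hleast : IsLeast {j | RankMetric.IsIMRD C j}
        (k + 2 - RankMetric.minDist (RankMetric.dual C)) :=
      ⟨(hMRD _).2 (by omega), fun j hj => by have := (hMRD j).1 hj; omega⟩
    constructor
    · intro hi
      have := hi.unique hleast
      omega
    · intro hi
      have : i = k + 2 - RankMetric.minDist (RankMetric.dual C) := by omega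
      rw [this]
      exact hleast
  · have : (((k : ℤ) + 1 - RankMetric.minDist (RankMetric.dual C) : ℤ) : ℚ) = k ↔
        RankMetric.minDist (RankMetric.dual C) = 1 := by
      rw [show (k : ℚ) = ((k : ℤ) : ℚ) from (Int.cast_natCast k).symm, Int.cast_inj]
      omega
    rw [this]
    omega
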